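/- Let $X$ be a real Hilbert space (of finite or infinite dimension). A subset of $X$ is called polyhedral if it is the intersection of finitely many closed halfspaces $\{x \in X : \langle a, x\rangle \le \beta\}$ with $a \in X\setminus\{0\}$ and $\beta \in \mathbb{R}$, and a polyhedral cone is a polyhedral set $C$ such that $\{t c : t > 0,\ c \in C\} = C$. For a nonempty closed convex set $C \subseteq X$, let $P_C$ denote the projector onto $C$, which maps each $x \in X$ to its unique nearest point in $C$. Let $\mathcal{C}$ be a nonempty finite collection of nonempty polyhedral cones in $X$, let $\lambda \in \left]0,1\right]$ and let $x^{(0)} \in X$. Let the sequence $(x^{(n)})_{n\in\mathbb{N}}$ be generated by $$x^{(n+1)} = (1-\lambda_n)\,x^{(n)} + \lambda_n P_{C_n} x^{(n)} \qquad (n \in \mathbb{N}),$$ where for every $n$ the set $C_n \in \mathcal{C}$ and the number $\lambda_n \in [\lambda, 2-\lambda]$ are chosen arbitrarily. Then $$\sum_{n=0}^{\infty} \bigl\|x^{(n+1)} - x^{(n)}\bigr\|^{\gamma} < +\infty \qquad \text{for all } \gamma > 0.$$ -/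

import Mathlib

open scoped Pointwise

namespace PolyCone

variable {X : Type*} [NormedAddCommGroup X] [InnerProductSpace ℝ X]

/-- A closed halfspace of `X`: a set `{x | ⟪a, x⟫ ≤ β}` with `a ≠ 0` and `β` real. -/
def IsClosedHalfspace (H : Set X) : Prop :=
  ∃ a : X, a ≠ 0 ∧ ∃ β : ℝ, H = {x : X | inner ℝ a x ≤ β}

/-- A polyhedral set: the intersection of finitely many closed halfspaces (the intersection of
the empty family is the whole space). -/
def IsPolyhedral (P : Set X) : Prop :=
  ∃ F : Set (Set X), F.Finite ∧ (∀ H ∈ F, IsClosedHalfspace H) ∧ P = ⋂₀ F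

/-- A cone: a set `C` with `ℝ₊₊ C = C`, where `ℝ₊₊` is the set of positive reals. -/
def IsCone (C : Set X) : Prop :=
  Set.Ioi (0 : ℝ) • C = C

/-- A polyhedral cone: a polyhedral set that is a cone. -/
def IsPolyhedralCone (C : Set X) : Prop :=
  IsPolyhedral C ∧ IsCone C

/-- `p` is a point of `C` that is nearest to `x`. -/
def IsNearestPoint (C : Set X) (x p : X) : Prop :=
  p ∈ C ∧ ∀ y ∈ C, ‖x - p‖ ≤ ‖x - y‖

/-- The projector `P_C`, which maps `x` to its nearest point in `C`. For a nonempty closed convex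
subset `C` of a Hilbert space this point exists and is unique, see `isNearestPoint_iff`. -/
noncomputable def projector (C : Set X) (x : X) : X :=
  Classical.epsilon (fun p : X => IsNearestPoint C x p)

/-- The set of relaxed projectors `(1 - μ) Id + μ P_C` with `C ∈ 𝒞` and `μ ∈ Λ`. -/
def relaxedProjectors (𝒞 : Set (Set X)) (Λ : Set ℝ) : Set (X → X) :=
  {R | ∃ C ∈ 𝒞, ∃ μ ∈ Λ, R = fun x => (1 - μ) • x + μ • projector C x}

/-- A polyhedral set is closed and convex. -/
theorem IsPolyhedral.isClosed_convex {P : Set X} (hP : IsPolyhedral P) :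
    IsClosed P ∧ Convex ℝ P := by
  obtain ⟨F, -, hF, rfl⟩ := hP
  constructor
  · refine isClosed_sInter fun H hH => ?_
    obtain ⟨a, -, β, rfl⟩ := hF H hH
    exact isClosed_le (by fun_prop) continuous_const
  · refine convex_sInter fun H hH => ?_
    obtain ⟨a, -, β, rfl⟩ := hF H hH
    exact convex_halfSpace_le (innerₛₗ ℝ a).isLinear β

/-- In a Hilbert space, `projector C x` is the one and only nearest point to `x` in a nonempty
closed convex set `C`. -/
theorem isNearestPoint_iff [CompleteSpace X] {C : Set X} (hne : C.Nonempty) (hcl : IsClosed C)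
    (hco : Convex ℝ C) (x p : X) : IsNearestPoint C x p ↔ p = projector C x := by
  have inf_eq : ∀ q : X, IsNearestPoint C x q → ‖x - q‖ = ⨅ w : C, ‖x - w‖ := by
    intro q hq
    have : Nonempty C := ⟨⟨q, hq.1⟩⟩
    refine le_antisymm (le_ciInf fun w => hq.2 w w.2) ?_
    exact ciInf_le (f := fun w : C => ‖x - w‖)
      ⟨0, Set.forall_mem_range.2 fun w => norm_nonneg _⟩ ⟨q, hq.1⟩
  have ex : ∃ q : X, IsNearestPoint C x q := by
    obtain ⟨q, hq, hqe⟩ := exists_norm_eq_iInf_of_complete_convex hne hcl.isComplete hco x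
    refine ⟨q, hq, fun y hy => hqe.trans_le ?_⟩
    exact ciInf_le (f := fun w : C => ‖x - w‖)
      ⟨0, Set.forall_mem_range.2 fun w => norm_nonneg _⟩ ⟨y, hy⟩
  have spec : IsNearestPoint C x (projector C x) := Classical.epsilon_spec ex
  refine ⟨fun hp => ?_, fun h => h ▸ spec⟩
  have h1 := (norm_eq_iInf_iff_real_inner_le_zero hco hp.1).1 (inf_eq p hp) _ spec.1
  have h2 := (norm_eq_iInf_iff_real_inner_le_zero hco spec.1).1 (inf_eq _ spec) _ hp.1
  have h3 : inner ℝ (p - projector C x) (p - projector C x) ≤ (0 : ℝ) := by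
    have e : inner ℝ (p - projector C x) (p - projector C x)
        = (inner ℝ (x - p) (projector C x - p) : ℝ)
          + inner ℝ (x - projector C x) (p - projector C x) := by
      rw [← neg_sub p (projector C x), inner_neg_right, ← sub_eq_neg_add, ← inner_sub_left]
      congr 1
      abel
    linarith
  rw [real_inner_self_eq_norm_sq] at h3
  have h4 : ‖p - projector C x‖ = 0 := by nlinarith [sq_nonneg ‖p - projector C x‖]
  exact sub_eq_zero.1 (norm_eq_zero.1 h4)

end PolyCone

namespace PolyCone

open Module

variable {X : Type*} [NormedAddCommGroup X] [InnerProductSpace ℝ X]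

/-! By optimality, `x - P_C x` lies in the span of the normals of `C` active at `P_C x`, and `P_C x`
is orthogonal to that span. So every step is a relaxed projection onto `Mᗮ`, with `M` from a finite
family of finite-dimensional subspaces, and the cones can be forgotten
(`IsPolyhedralCone.exists_finite_steps`).

Let a block of steps use subspaces whose sum is `V`. Starting inside `V`, the block shrinks the norm
by a factor `ρ < 1` depending only on the family and a bound on `dim V`, not on the block's length
(`exists_contraction_sq`). To sum the powers, cut the trajectory each time the subspaces used since
the last cut span `V`. Within a block, all steps but the last span less, so induction on dimension
bounds their sum; the starting norms of the blocks decay geometrically (`exists_sum_rpow_le`). -/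

/-- `x'` arises from `x` by a relaxed projection onto `Mᗮ`, with relaxation parameter in
`[lam, 2 - lam]`: the point `p` below is the orthogonal projection of `x` onto `M`. -/
def Step (lam : ℝ) (M : Submodule ℝ X) (x x' : X) : Prop :=
  ∃ μ ∈ Set.Icc lam (2 - lam), ∃ p ∈ M, x - p ∈ Mᗮ ∧ x' = x - μ • p

/-- The first `n` steps of `x` are relaxed projections onto the complements of `M 0, M 1, …`,
which belong to `𝓜`. -/
def IsTrajectory (lam : ℝ) (𝓜 : Set (Submodule ℝ X)) (M : ℕ → Submodule ℝ X) (x : ℕ → X)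
    (n : ℕ) : Prop :=
  ∀ i < n, M i ∈ 𝓜 ∧ Step lam (M i) (x i) (x (i + 1))

/-- The sum of the first `n` subspaces. -/
def supUpTo (M : ℕ → Submodule ℝ X) (n : ℕ) : Submodule ℝ X :=
  (Finset.range n).sup M

theorem supUpTo_succ (M : ℕ → Submodule ℝ X) (n : ℕ) :
    supUpTo M (n + 1) = M n ⊔ supUpTo M n := by
  simp [supUpTo, Finset.range_add_one]

theorem supUpTo_mono (M : ℕ → Submodule ℝ X) {m n : ℕ} (h : m ≤ n) :
    supUpTo M m ≤ supUpTo M n :=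
  Finset.sup_mono (by simpa using h)

theorem le_supUpTo (M : ℕ → Submodule ℝ X) {i n : ℕ} (h : i < n) : M i ≤ supUpTo M n :=
  Finset.le_sup (f := M) (Finset.mem_range.2 h)

theorem supUpTo_le_iff {M : ℕ → Submodule ℝ X} {n : ℕ} {V : Submodule ℝ X} :
    supUpTo M n ≤ V ↔ ∀ i < n, M i ≤ V := by
  simp [supUpTo]

theorem Step.norm_sq_le {lam : ℝ} {M : Submodule ℝ X} {x x' : X}
    (h : Step lam M x x') :
    ∃ p ∈ M, x - p ∈ Mᗮ ∧ ‖x'‖ ^ 2 ≤ ‖x‖ ^ 2 - lam * (2 - lam) * ‖p‖ ^ 2 := by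
  obtain ⟨μ, ⟨h1, h2⟩, p, hp, hxp, rfl⟩ := h
  refine ⟨p, hp, hxp, ?_⟩
  have h3 : inner ℝ x p = ‖p‖ ^ 2 := by
    have := Submodule.inner_left_of_mem_orthogonal hp hxp
    rw [inner_sub_left, real_inner_self_eq_norm_sq] at this
    linarith
  rw [norm_sub_sq_real, inner_smul_right, h3, norm_smul, mul_pow, Real.norm_eq_abs, sq_abs]
  -- The product of these two factors is `μ(2 - μ) - lam(2 - lam)`.
  nlinarith [mul_nonneg (mul_nonneg (sub_nonneg.2 h1) (sub_nonneg.2 h2)) (sq_nonneg ‖p‖)]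

theorem Step.norm_le {lam : ℝ} (hlam : lam ∈ Set.Ioc (0 : ℝ) 1) {M : Submodule ℝ X} {x x' : X}
    (h : Step lam M x x') : ‖x'‖ ≤ ‖x‖ := by
  obtain ⟨p, -, -, hp⟩ := h.norm_sq_le
  have : 0 ≤ lam * (2 - lam) * ‖p‖ ^ 2 :=
    mul_nonneg (mul_nonneg hlam.1.le (by linarith [hlam.2])) (sq_nonneg _)
  exact (sq_le_sq₀ (norm_nonneg _) (norm_nonneg _)).1 (by linarith)

theorem Step.sub_mem {lam : ℝ} {M : Submodule ℝ X} {x x' : X} (h : Step lam M x x') :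
    x' - x ∈ M := by
  obtain ⟨μ, -, p, hp, -, rfl⟩ := h
  simpa using M.smul_mem μ hp

theorem Step.sub_orthogonal {lam : ℝ} {M : Submodule ℝ X} {x x' u : X} (h : Step lam M x x')
    (hu : u ∈ Mᗮ) : Step lam M (x - u) (x' - u) := by
  obtain ⟨μ, hμ, p, hp, hxp, rfl⟩ := h
  refine ⟨μ, hμ, p, hp, ?_, by abel⟩
  rw [sub_right_comm]
  exact Submodule.sub_mem _ hxp hu

namespace IsTrajectory

variable {lam : ℝ} {𝓜 : Set (Submodule ℝ X)} {M : ℕ → Submodule ℝ X} {x : ℕ → X} {m n : ℕ}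

theorem mono (h : IsTrajectory lam 𝓜 M x n) (hmn : m ≤ n) : IsTrajectory lam 𝓜 M x m :=
  fun i hi => h i (hi.trans_le hmn)

theorem shift (h : IsTrajectory lam 𝓜 M x n) (k : ℕ) :
    IsTrajectory lam 𝓜 (fun i => M (i + k)) (fun i => x (i + k)) (n - k) := by
  intro i hi
  have := h (i + k) (by omega)
  rwa [add_right_comm] at this

theorem sub_orthogonal (h : IsTrajectory lam 𝓜 M x n) {u : X} (hu : u ∈ (supUpTo M n)ᗮ) :
    IsTrajectory lam 𝓜 M (fun i => x i - u) n := fun i hi =>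
  ⟨(h i hi).1, (h i hi).2.sub_orthogonal (Submodule.orthogonal_le (le_supUpTo M hi) hu)⟩

theorem norm_le (hlam : lam ∈ Set.Ioc (0 : ℝ) 1) (h : IsTrajectory lam 𝓜 M x n) {i j : ℕ}
    (hij : i ≤ j) (hjn : j ≤ n) : ‖x j‖ ≤ ‖x i‖ := by
  induction j, hij using Nat.le_induction with
  | base => exact le_rfl
  | succ j _ ih => exact ((h j (by omega)).2.norm_le hlam).trans (ih (by omega))

theorem mem (h : IsTrajectory lam 𝓜 M x n) {V : Submodule ℝ X} (hV : supUpTo M n ≤ V)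
    (hx : x 0 ∈ V) {i : ℕ} (hi : i ≤ n) : x i ∈ V := by
  induction i with
  | zero => exact hx
  | succ i ih =>
    have := V.add_mem (ih (by omega)) (supUpTo_le_iff.1 hV i hi (h i hi).2.sub_mem)
    simpa using this

theorem finiteDimensional (hfd : ∀ M ∈ 𝓜, FiniteDimensional ℝ M)
    (h : IsTrajectory lam 𝓜 M x n) : FiniteDimensional ℝ (supUpTo M n) :=
  Module.Finite.iff_fg.2 <| Submodule.fg_finset_sup _ _ fun i hi =>
    Module.Finite.iff_fg.1 (hfd _ (h i (Finset.mem_range.1 hi)).1)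

end IsTrajectory

theorem finiteDimensional_sSup {𝓜 : Set (Submodule ℝ X)} (hfin : 𝓜.Finite)
    (hfd : ∀ M ∈ 𝓜, FiniteDimensional ℝ M) : FiniteDimensional ℝ (sSup 𝓜 : Submodule ℝ X) := by
  rw [← hfin.coe_toFinset, ← Finset.sup_id_eq_sSup]
  exact Module.Finite.iff_fg.2 <| Submodule.fg_finset_sup _ _ fun M hM =>
    Module.Finite.iff_fg.1 (hfd M (by simpa using hM))

/-! ### Uniform contraction -/

/-- On `(W ⊔ N) ⊓ Wᗮ` the orthogonal projection onto `N` is bounded below. -/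
theorem exists_pos_mul_norm_le (W N : Submodule ℝ X) [FiniteDimensional ℝ W]
    [FiniteDimensional ℝ N] :
    ∃ c > 0, ∀ u ∈ (N ⊔ W) ⊓ Wᗮ, c * ‖u‖ ≤ ‖N.starProjection u‖ := by
  let U : Submodule ℝ X := (N ⊔ W) ⊓ Wᗮ
  have : FiniteDimensional ℝ U := Submodule.finiteDimensional_of_le inf_le_left
  let f : U →ₗ[ℝ] X := N.starProjection.toLinearMap ∘ₗ U.subtype
  have hf : f.ker = ⊥ := by
    rw [LinearMap.ker_eq_bot']
    intro u hu
    have h1 : (u : X) ∈ Nᗮ := by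
      have := N.sub_starProjection_mem_orthogonal (u : X)
      have h0 : N.starProjection (u : X) = 0 := hu
      rwa [h0, sub_zero] at this
    have h2 : (u : X) ∈ (N ⊔ W)ᗮ := by
      rw [← Submodule.inf_orthogonal]
      exact ⟨h1, u.2.2⟩
    exact Subtype.ext (inner_self_eq_zero.1
      (Submodule.inner_right_of_mem_orthogonal (𝕜 := ℝ) u.2.1 h2))
  obtain ⟨K, hK, hKf⟩ := f.exists_antilipschitzWith hf
  refine ⟨(K : ℝ)⁻¹, by positivity, fun u hu => ?_⟩
  have := hKf.le_mul_dist ⟨u, hu⟩ 0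
  rw [map_zero, dist_zero_right, dist_zero_right] at this
  rw [inv_mul_le_iff₀ (by positivity)]
  exact this

/-- A new subspace must see the part `u` of its span orthogonal to the earlier ones, up to the error
`x - u`. The constant is uniform because a finite family has only finitely many partial sums. -/
theorem exists_uniform_lower_bound {𝓜 : Set (Submodule ℝ X)} (hfin : 𝓜.Finite)
    (hfd : ∀ M ∈ 𝓜, FiniteDimensional ℝ M) :
    ∃ c > 0, c ≤ 1 ∧ ∀ (M : ℕ → Submodule ℝ X) (k : ℕ), (∀ i ≤ k, M i ∈ 𝓜) →
      ∀ u ∈ supUpTo M (k + 1), u ∈ (supUpTo M k)ᗮ → ∀ x, ∀ p ∈ M k, x - p ∈ (M k)ᗮ →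
        c * ‖u‖ ≤ ‖p‖ + ‖x - u‖ := by
  have key : ∀ S ∈ 𝓜.powerset, ∀ N ∈ 𝓜, ∀ᶠ c : ℝ in nhdsWithin 0 (Set.Ioi 0),
      ∀ u ∈ (N ⊔ sSup S) ⊓ (sSup S)ᗮ, ∀ x, ∀ p ∈ N, x - p ∈ Nᗮ →
        c * ‖u‖ ≤ ‖p‖ + ‖x - u‖ := by
    intro S hS N hN
    have := hfd N hN
    have := finiteDimensional_sSup (hfin.subset hS) fun M hM => hfd M (hS hM)
    obtain ⟨c, hc, h⟩ := exists_pos_mul_norm_le (sSup S) N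
    filter_upwards [Ioo_mem_nhdsGT hc] with c' hc' u hu x p hp hxp
    have e : N.starProjection x = p := Submodule.eq_starProjection_of_mem_orthogonal hp hxp
    calc c' * ‖u‖ ≤ c * ‖u‖ := by gcongr; exact hc'.2.le
      _ ≤ ‖N.starProjection u‖ := h u hu
      _ = ‖p - N.starProjection (x - u)‖ := by rw [map_sub, e]; congr 1; abel
      _ ≤ ‖p‖ + ‖N.starProjection (x - u)‖ := norm_sub_le _ _
      _ ≤ ‖p‖ + ‖x - u‖ := by gcongr; exact N.norm_starProjection_apply_le _
  have key' := (Filter.eventually_all_finite hfin.powerset).2 fun S hS =>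
    (Filter.eventually_all_finite hfin).2 (key S hS)
  obtain ⟨c, hc, hc0⟩ := (key'.and (Ioo_mem_nhdsGT (zero_lt_one (α := ℝ)))).exists
  refine ⟨c, hc0.1, hc0.2.le, fun M k hM u hu hu' x p hp hxp => ?_⟩
  have e : supUpTo M k = sSup (M '' (Finset.range k)) := Finset.sup_eq_sSup_image _ _
  rw [supUpTo_succ, e] at hu
  rw [e] at hu'
  refine hc (M '' (Finset.range k)) ?_ (M k) (hM k le_rfl) u ⟨hu, hu'⟩ x p hp hxp
  rintro _ ⟨i, hi, rfl⟩
  exact hM i (by simp at hi; omega)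

theorem exists_lt_finrank_supUpTo {M : ℕ → Submodule ℝ X} {n d : ℕ}
    (h : d < finrank ℝ (supUpTo M n)) :
    ∃ k < n, finrank ℝ (supUpTo M k) ≤ d ∧ d < finrank ℝ (supUpTo M (k + 1)) := by
  classical
  have hex : ∃ m, d < finrank ℝ (supUpTo M m) := ⟨n, h⟩
  have h1 := Nat.find_spec hex
  have h0 : Nat.find hex ≠ 0 := by
    intro h0
    rw [h0, supUpTo, Finset.range_zero, Finset.sup_empty, finrank_bot] at h1
    omega
  obtain ⟨k, hk⟩ := Nat.exists_eq_succ_of_ne_zero h0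
  refine ⟨k, ?_, not_lt.1 (Nat.find_min hex (by omega)), by rw [hk] at h1; exact h1⟩
  have := Nat.find_min' hex h
  omega

/-- A step that enlarges the span of the subspaces used so far contracts uniformly, if the
preceding steps contract on that span. -/
theorem one_step_contraction {a b b' y q s c δ ρ : ℝ} (hc : 0 < c) (hc1 : c ≤ 1) (hδ : 0 < δ)
    (hρ : ρ < 1) (ha : 0 ≤ a) (hb : 0 ≤ b) (hb'0 : 0 ≤ b')
    (hb' : b' ^ 2 ≤ ρ * b ^ 2) (hs : s = a ^ 2 + b' ^ 2) (hy : y ≤ s - δ * q ^ 2)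
    (hcq : c * a ≤ q + b') :
    y ≤ max (1 - δ * c ^ 2 / 8) (1 - (1 - ρ) * c ^ 2 / 5) * (a ^ 2 + b ^ 2) := by
  have hbb : b' ^ 2 ≤ b ^ 2 := by nlinarith [sq_nonneg b]
  have hbb' : b' ≤ b := (sq_le_sq₀ hb'0 hb).1 hbb
  have hc2 : c ^ 2 ≤ 1 := by nlinarith
  -- If `b` is small, then `q ≥ c * a / 2` and the new step loses enough; otherwise `b` carries a
  -- fixed share of the norm and its earlier contraction suffices.
  rcases le_total b (c / 2 * a) with h | h
  · refine le_trans ?_ (mul_le_mul_of_nonneg_right (le_max_left _ _) (by positivity))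
    have h1 : c / 2 * a ≤ q := by nlinarith
    have h2 : (c / 2 * a) ^ 2 ≤ q ^ 2 := by gcongr
    have h3 : b ^ 2 ≤ (c / 2 * a) ^ 2 := by gcongr
    have h4 : b ^ 2 ≤ a ^ 2 := by nlinarith [sq_nonneg a]
    have h5 : δ * (c / 2 * a) ^ 2 ≤ δ * q ^ 2 := by gcongr
    have h6 : δ * c ^ 2 / 8 * (a ^ 2 + b ^ 2) ≤ δ * c ^ 2 / 8 * (a ^ 2 + a ^ 2) := by gcongr
    nlinarith
  · refine le_trans ?_ (mul_le_mul_of_nonneg_right (le_max_right _ _) (by positivity))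
    have h3 : (c / 2 * a) ^ 2 ≤ b ^ 2 := by gcongr
    have h4 : c ^ 2 * (a ^ 2 + b ^ 2) ≤ 5 * b ^ 2 := by nlinarith [sq_nonneg b]
    have h5 : (1 - ρ) * (c ^ 2 * (a ^ 2 + b ^ 2)) ≤ (1 - ρ) * (5 * b ^ 2) := by
      gcongr
    have h6 : 0 ≤ δ * q ^ 2 := by positivity
    nlinarith

/-- Words in relaxed projections contract uniformly on the span of the subspaces involved. -/
theorem exists_contraction_sq {lam : ℝ} (hlam : lam ∈ Set.Ioc (0 : ℝ) 1)
    {𝓜 : Set (Submodule ℝ X)} (hfin : 𝓜.Finite) (hfd : ∀ M ∈ 𝓜, FiniteDimensional ℝ M) (d : ℕ) :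
    ∃ ρ, 0 ≤ ρ ∧ ρ < 1 ∧ ∀ (M : ℕ → Submodule ℝ X) (x : ℕ → X) (n : ℕ),
      IsTrajectory lam 𝓜 M x n → finrank ℝ (supUpTo M n) ≤ d → x 0 ∈ supUpTo M n →
        ‖x n‖ ^ 2 ≤ ρ * ‖x 0‖ ^ 2 := by
  induction d with
  | zero =>
    refine ⟨0, le_rfl, zero_lt_one, fun M x n hT hd hx => ?_⟩
    have := hT.finiteDimensional hfd
    rw [Submodule.finrank_eq_zero.1 (Nat.le_zero.1 hd), Submodule.mem_bot] at hx
    have h := hT.norm_le hlam (Nat.zero_le n) le_rfl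
    rw [hx, norm_zero] at h
    simp [le_antisymm h (norm_nonneg _)]
  | succ d ih =>
    obtain ⟨ρ, hρ0, hρ1, ih⟩ := ih
    obtain ⟨c, hc0, hc1, hc⟩ := exists_uniform_lower_bound hfin hfd
    have hδ : 0 < lam * (2 - lam) := mul_pos hlam.1 (by linarith [hlam.2])
    set σ := max (1 - lam * (2 - lam) * c ^ 2 / 8) (1 - (1 - ρ) * c ^ 2 / 5) with hσ
    refine ⟨max ρ σ, hρ0.trans (le_max_left _ _), max_lt hρ1 (max_lt ?_ ?_), ?_⟩
    · have : 0 < lam * (2 - lam) * c ^ 2 := by positivity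
      linarith
    · have : 0 < (1 - ρ) * c ^ 2 := mul_pos (by linarith) (by positivity)
      linarith
    intro M x n hT hd hx
    rcases le_or_gt (finrank ℝ (supUpTo M n)) d with h | h
    · exact (ih M x n hT h hx).trans
        (mul_le_mul_of_nonneg_right (le_max_left _ _) (sq_nonneg _))
    refine le_trans ?_ (mul_le_mul_of_nonneg_right (le_max_right _ _) (sq_nonneg _))
    obtain ⟨k, hkn, hk, hk'⟩ := exists_lt_finrank_supUpTo h
    have := hT.finiteDimensional hfd
    have := (hT.mono hkn.le).finiteDimensional hfd
    have e : supUpTo M (k + 1) = supUpTo M n :=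
      Submodule.eq_of_le_of_finrank_le (supUpTo_mono M hkn) (by omega)
    -- The first `k` steps fix `u` and act on `v` alone, so induction applies to `v`.
    obtain ⟨v, hv, u, hu, hvu⟩ := (supUpTo M k).exists_add_mem_mem_orthogonal (x 0)
    have hTk := (hT.mono hkn.le).sub_orthogonal hu
    have hv0 : x 0 - u = v := by rw [hvu]; abel
    have hvk : x k - u ∈ supUpTo M k :=
      hTk.mem (i := k) le_rfl (by simpa only [hv0] using hv) le_rfl
    have h1 : ‖x k - u‖ ^ 2 ≤ ρ * ‖v‖ ^ 2 := by
      have := ih M _ k hTk hk (by simpa only [hv0] using hv)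
      simpa only [hv0] using this
    have huV : u ∈ supUpTo M (k + 1) := by
      have : u = x 0 - v := by rw [hvu]; abel
      rw [this, e]
      exact Submodule.sub_mem _ hx (supUpTo_mono M hkn.le hv)
    obtain ⟨p, hp, hxp, hle⟩ := (hT k hkn).2.norm_sq_le
    have hcp := hc M k (fun i hi => (hT i (by omega)).1) u huV hu (x k) p hp hxp
    have pyth : ∀ w ∈ supUpTo M k, ‖w + u‖ ^ 2 = ‖u‖ ^ 2 + ‖w‖ ^ 2 := by
      intro w hw
      rw [norm_add_sq_real, Submodule.inner_right_of_mem_orthogonal hw hu]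
      ring
    have hs : ‖x k‖ ^ 2 = ‖u‖ ^ 2 + ‖x k - u‖ ^ 2 := by
      rw [← pyth _ hvk, sub_add_cancel]
    have hmain := one_step_contraction hc0 hc1 hδ hρ1 (norm_nonneg u) (norm_nonneg v)
      (norm_nonneg _) h1 hs hle hcp
    rw [← pyth v hv, ← hvu] at hmain
    refine le_trans ?_ hmain
    gcongr
    exact hT.norm_le hlam hkn le_rfl

theorem exists_contraction {lam : ℝ} (hlam : lam ∈ Set.Ioc (0 : ℝ) 1)
    {𝓜 : Set (Submodule ℝ X)} (hfin : 𝓜.Finite) (hfd : ∀ M ∈ 𝓜, FiniteDimensional ℝ M) (d : ℕ) :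
    ∃ ρ, 0 ≤ ρ ∧ ρ < 1 ∧ ∀ (M : ℕ → Submodule ℝ X) (x : ℕ → X) (n : ℕ),
      IsTrajectory lam 𝓜 M x n → finrank ℝ (supUpTo M n) ≤ d → x 0 ∈ supUpTo M n →
        ‖x n‖ ≤ ρ * ‖x 0‖ := by
  obtain ⟨ρ, hρ0, hρ1, h⟩ := exists_contraction_sq hlam hfin hfd d
  refine ⟨√ρ, Real.sqrt_nonneg _, by rw [Real.sqrt_lt' one_pos]; simpa, ?_⟩
  intro M x n hT hd hx
  rw [← sq_le_sq₀ (norm_nonneg _) (by positivity), mul_pow, Real.sq_sqrt hρ0]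
  exact h M x n hT hd hx

/-! ### Summing the step lengths -/

/-- The `γ`-th powers of the step lengths have a sum bounded by a multiple of `‖x 0‖ ^ γ`. -/
theorem exists_sum_rpow_le {lam : ℝ} (hlam : lam ∈ Set.Ioc (0 : ℝ) 1)
    {𝓜 : Set (Submodule ℝ X)} (hfin : 𝓜.Finite) (hfd : ∀ M ∈ 𝓜, FiniteDimensional ℝ M)
    {γ : ℝ} (hγ : 0 < γ) (d : ℕ) :
    ∃ K, 0 ≤ K ∧ ∀ (M : ℕ → Submodule ℝ X) (x : ℕ → X) (n : ℕ),
      IsTrajectory lam 𝓜 M x n → finrank ℝ (supUpTo M n) ≤ d →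
        ∑ i ∈ Finset.range n, ‖x (i + 1) - x i‖ ^ γ ≤ K * ‖x 0‖ ^ γ := by
  induction d with
  | zero =>
    refine ⟨0, le_rfl, fun M x n hT hd => ?_⟩
    have := hT.finiteDimensional hfd
    have hbot := Submodule.finrank_eq_zero.1 (Nat.le_zero.1 hd)
    rw [zero_mul]
    refine (Finset.sum_eq_zero fun i hi => ?_).le
    have hi := Finset.mem_range.1 hi
    have h := le_supUpTo M hi (hT i hi).2.sub_mem
    rw [hbot, Submodule.mem_bot] at h
    rw [h, norm_zero, Real.zero_rpow hγ.ne']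
  | succ d ih =>
    obtain ⟨K, hK0, ih⟩ := ih
    obtain ⟨ρ, hρ0, hρ1, hρ⟩ := exists_contraction hlam hfin hfd (d + 1)
    have hργ : ρ ^ γ < 1 := Real.rpow_lt_one hρ0 hρ1 hγ
    have hργ0 : 0 ≤ ρ ^ γ := Real.rpow_nonneg hρ0 _
    -- Solves `L = K + 2 ^ γ + L * ρ ^ γ`: the early steps of a block, its last step, and everything
    -- after it.
    set L := (K + 2 ^ γ) / (1 - ρ ^ γ) with hL
    have hLeq : K + 2 ^ γ + L * ρ ^ γ = L := by
      have : (1 - ρ ^ γ) ≠ 0 := by linarith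
      rw [hL]
      field_simp
      ring
    have hL0 : 0 ≤ L := div_nonneg (by positivity) (by linarith)
    have hKL : K ≤ L := by
      have : (0 : ℝ) ≤ 2 ^ γ := by positivity
      nlinarith [mul_nonneg hL0 hργ0]
    -- `V` stays fixed while the trajectory is restarted, since the remaining subspaces may span
    -- less than `V`.
    have inside : ∀ (V : Submodule ℝ X) (n : ℕ) (M : ℕ → Submodule ℝ X) (x : ℕ → X),
        FiniteDimensional ℝ V → finrank ℝ V ≤ d + 1 → IsTrajectory lam 𝓜 M x n →
        supUpTo M n ≤ V → x 0 ∈ V →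
        ∑ i ∈ Finset.range n, ‖x (i + 1) - x i‖ ^ γ ≤ L * ‖x 0‖ ^ γ := by
      intro V n
      induction n using Nat.strong_induction_on with
      | _ n ihn =>
      intro M x hfdV hV hT hMV hx
      rcases le_or_gt (finrank ℝ (supUpTo M n)) d with h | h
      · exact (ih M x n hT h).trans (by gcongr)
      obtain ⟨k, hkn, hk, hk'⟩ := exists_lt_finrank_supUpTo h
      have e : supUpTo M (k + 1) = V :=
        Submodule.eq_of_le_of_finrank_le ((supUpTo_mono M hkn).trans hMV) (by omega)
      have hTk1 := hT.mono (Nat.succ_le_of_lt hkn)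
      have h1 := ih M x k (hT.mono hkn.le) hk
      have h2 : ‖x (k + 1) - x k‖ ^ γ ≤ 2 ^ γ * ‖x 0‖ ^ γ := by
        rw [← Real.mul_rpow (by norm_num) (norm_nonneg _)]
        refine Real.rpow_le_rpow (norm_nonneg _) ?_ hγ.le
        linarith [norm_sub_le (x (k + 1)) (x k), hT.norm_le hlam (Nat.zero_le k) hkn.le,
          hT.norm_le hlam (Nat.zero_le (k + 1)) hkn]
      have h3 : ‖x (k + 1)‖ ^ γ ≤ ρ ^ γ * ‖x 0‖ ^ γ := by
        rw [← Real.mul_rpow hρ0 (norm_nonneg _)]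
        exact Real.rpow_le_rpow (norm_nonneg _)
          (hρ M x (k + 1) hTk1 (by rwa [e]) (by rwa [e])) hγ.le
      have h4 := ihn (n - (k + 1)) (by omega) _ _ hfdV hV (hT.shift (k + 1))
        (supUpTo_le_iff.2 fun i hi => supUpTo_le_iff.1 hMV _ (by omega))
        (by simpa using hTk1.mem e.le hx le_rfl)
      simp only [zero_add] at h4
      have hsplit : ∑ i ∈ Finset.range n, ‖x (i + 1) - x i‖ ^ γ
          = ∑ i ∈ Finset.range k, ‖x (i + 1) - x i‖ ^ γ + ‖x (k + 1) - x k‖ ^ γ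
            + ∑ i ∈ Finset.range (n - (k + 1)),
                ‖x (i + 1 + (k + 1)) - x (i + (k + 1))‖ ^ γ := by
        rw [← Finset.sum_range_succ (fun i => ‖x (i + 1) - x i‖ ^ γ)]
        conv_lhs => rw [← Nat.add_sub_cancel' (Nat.succ_le_of_lt hkn), Finset.sum_range_add]
        congr 1
        refine Finset.sum_congr rfl fun i _ => ?_
        rw [show k.succ + i = i + (k + 1) by omega, show i + (k + 1) + 1 = i + 1 + (k + 1) by omega]
      rw [hsplit]
      have h5 := mul_le_mul_of_nonneg_left h3 hL0
      calc _ ≤ K * ‖x 0‖ ^ γ + 2 ^ γ * ‖x 0‖ ^ γ + L * (ρ ^ γ * ‖x 0‖ ^ γ) := by linarith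
        _ = (K + 2 ^ γ + L * ρ ^ γ) * ‖x 0‖ ^ γ := by ring
        _ = L * ‖x 0‖ ^ γ := by rw [hLeq]
    refine ⟨L, hL0, fun M x n hT hd => ?_⟩
    have hfdV := hT.finiteDimensional hfd
    -- Removing the component `u`, which no step moves, leaves the increments unchanged.
    obtain ⟨v, hv, u, hu, hvu⟩ := (supUpTo M n).exists_add_mem_mem_orthogonal (x 0)
    have hv0 : x 0 - u = v := by rw [hvu]; abel
    have h := inside _ n M _ hfdV hd (hT.sub_orthogonal hu) le_rfl (by simpa only [hv0] using hv)
    simp only [sub_sub_sub_cancel_right, hv0] at h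
    refine h.trans ?_
    have hle : ‖v‖ ≤ ‖x 0‖ := by
      rw [← sq_le_sq₀ (norm_nonneg _) (norm_nonneg _), hvu, norm_add_sq_real,
        Submodule.inner_right_of_mem_orthogonal hv hu]
      nlinarith [sq_nonneg ‖u‖]
    gcongr

/-! ### From polyhedral cones to subspaces -/

/-- A nonempty polyhedral cone is cut out by finitely many homogeneous linear inequalities. -/
theorem IsPolyhedralCone.exists_finite_normals {C : Set X} (hne : C.Nonempty)
    (hC : IsPolyhedralCone C) :
    ∃ A : Set X, A.Finite ∧ C = {x | ∀ a ∈ A, inner ℝ a x ≤ 0} := by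
  obtain ⟨⟨F, hFfin, hF, hCF⟩, hcone⟩ := hC
  choose! a _ β hβ using hF
  have hsmul : ∀ t : ℝ, 0 < t → ∀ x ∈ C, t • x ∈ C := by
    intro t ht x hx
    rw [← hcone]
    exact Set.smul_mem_smul ht hx
  have hmem : ∀ x, x ∈ C ↔ ∀ H ∈ F, inner ℝ (a H) x ≤ β H := by
    intro x
    rw [hCF, Set.mem_sInter]
    refine forall₂_congr fun H hH => ?_
    conv_lhs => rw [hβ H hH]
    rfl
  have hβ0 : ∀ H ∈ F, 0 ≤ β H := by
    intro H hH
    obtain ⟨x, hx⟩ := hne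
    by_contra! hneg
    set s : ℝ := inner ℝ (a H) x with hs
    have h1 : s ≤ β H := (hmem x).1 hx H hH
    -- This scaling makes the inner product `β H / 2`, which exceeds a negative `β H`.
    have h2 := (hmem _).1 (hsmul (β H / (2 * s)) (div_pos_of_neg_of_neg hneg (by linarith)) x hx) H hH
    have hs0 : s ≠ 0 := by linarith
    rw [inner_smul_right, ← hs, show β H / (2 * s) * s = β H / 2 by field_simp] at h2
    linarith
  refine ⟨a '' F, hFfin.image a, Set.ext fun x => ⟨fun hx => ?_, fun hx => ?_⟩⟩
  · rintro _ ⟨H, hH, rfl⟩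
    by_contra! hpos
    have ht : 0 < (β H + 1) / inner ℝ (a H) x := div_pos (by linarith [hβ0 H hH]) hpos
    have := (hmem _).1 (hsmul _ ht x hx) H hH
    rw [inner_smul_right, div_mul_cancel₀ _ hpos.ne'] at this
    linarith
  · exact (hmem x).2 fun H hH => (hx _ ⟨H, hH, rfl⟩).trans (hβ0 H hH)

/-- The residual of the projection `p` of `x` onto a polyhedral cone lies in the span of the
normals that are active at `p`. -/
theorem sub_mem_span_active {A : Set X} (hA : A.Finite) {x p : X}
    (hp : IsNearestPoint {x | ∀ a ∈ A, inner ℝ a x ≤ 0} x p) :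
    x - p ∈ Submodule.span ℝ {a ∈ A | inner ℝ a p = 0} := by
  set M := Submodule.span ℝ {a ∈ A | inner ℝ a p = 0} with hM
  have : FiniteDimensional ℝ M :=
    FiniteDimensional.span_of_finite ℝ (hA.subset (Set.sep_subset _ _))
  -- A short move from `p` along `y` stays in the cone: active constraints do not change, and
  -- inactive ones have slack.
  have hle : ∀ y ∈ Mᗮ, inner ℝ (x - p) y ≤ 0 := by
    intro y hy
    have hev : ∀ᶠ t : ℝ in nhdsWithin 0 (Set.Ioi 0), ∀ a ∈ A, inner ℝ a (p + t • y) ≤ 0 := by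
      refine (Filter.eventually_all_finite hA).2 fun a ha => ?_
      rcases (hp.1 a ha).lt_or_eq with h | h
      · have hcont : Continuous fun t : ℝ => inner ℝ a (p + t • y) := by fun_prop
        have := hcont.continuousAt.eventually_lt (continuousAt_const (x := (0 : ℝ)) (y := (0 : ℝ)))
          (by simpa using h)
        exact (this.filter_mono nhdsWithin_le_nhds).mono fun t ht => ht.le
      · refine Filter.Eventually.of_forall fun t => ?_
        have : inner ℝ a y = 0 :=
          Submodule.inner_right_of_mem_orthogonal (K := M)
            (Submodule.subset_span (Set.mem_sep ha h)) hy
        rw [inner_add_right, inner_smul_right, h, this]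
        simp
    by_contra! hpos
    have hsmall : ∀ᶠ t : ℝ in nhdsWithin 0 (Set.Ioi 0),
        t * ‖y‖ ^ 2 < 2 * inner ℝ (x - p) y := by
      have hcont : Continuous fun t : ℝ => t * ‖y‖ ^ 2 := by fun_prop
      exact (hcont.continuousAt.eventually_lt (continuousAt_const (x := (0 : ℝ)))
        (by simpa using hpos)).filter_mono nhdsWithin_le_nhds
    obtain ⟨t, ⟨ht1, ht2⟩, ht0⟩ := ((hev.and hsmall).and self_mem_nhdsWithin).exists
    have ht0 : 0 < t := ht0
    have h := hp.2 _ ht1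
    rw [← sq_le_sq₀ (norm_nonneg _) (norm_nonneg _), ← sub_sub, norm_sub_sq_real (x - p),
      inner_smul_right, norm_smul, mul_pow, Real.norm_eq_abs, sq_abs] at h
    nlinarith [mul_lt_mul_of_pos_left ht2 ht0]
  rw [← Submodule.orthogonal_orthogonal M, Submodule.mem_orthogonal']
  intro y hy
  refine le_antisymm (hle y hy) ?_
  have := hle (-y) (Submodule.neg_mem _ hy)
  rw [inner_neg_right] at this
  linarith

/-- Relaxed projections onto a polyhedral cone are relaxed projections onto the orthogonal
complements of the members of a finite family of finite-dimensional subspaces. -/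
theorem IsPolyhedralCone.exists_finite_steps [CompleteSpace X] {C : Set X} (hne : C.Nonempty)
    (hC : IsPolyhedralCone C) (lam : ℝ) :
    ∃ 𝓜 : Set (Submodule ℝ X), 𝓜.Finite ∧ (∀ M ∈ 𝓜, FiniteDimensional ℝ M) ∧
      ∀ x, ∀ μ ∈ Set.Icc lam (2 - lam), ∃ M ∈ 𝓜,
        Step lam M x ((1 - μ) • x + μ • projector C x) := by
  obtain ⟨hcl, hco⟩ := hC.1.isClosed_convex
  obtain ⟨A, hA, hCA⟩ := hC.exists_finite_normals hne
  refine ⟨Submodule.span ℝ '' A.powerset, hA.powerset.image _, ?_, fun x μ hμ => ?_⟩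
  · rintro _ ⟨S, hS, rfl⟩
    exact FiniteDimensional.span_of_finite ℝ (hA.subset hS)
  have hp := (isNearestPoint_iff hne hcl hco x _).2 rfl
  set p := projector C x
  rw [hCA] at hp
  refine ⟨_, ⟨{a ∈ A | inner ℝ a p = 0}, Set.sep_subset _ _, rfl⟩, μ, hμ, x - p,
    sub_mem_span_active hA hp, ?_, by module⟩
  rw [sub_sub_cancel, Submodule.mem_orthogonal]
  intro u hu
  induction hu using Submodule.span_induction with
  | mem a ha => exact ha.2
  | zero => exact inner_zero_left _
  | add a b _ _ ha hb => rw [inner_add_left, ha, hb, add_zero]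
  | smul t a _ ha => rw [inner_smul_left, ha, mul_zero]

end PolyCone

theorem theoremt {X : Type*} [NormedAddCommGroup X] [InnerProductSpace ℝ X] [CompleteSpace X]
    (𝒞 : Set (Set X)) (h𝒞_fin : 𝒞.Finite) (h𝒞_ne : 𝒞.Nonempty)
    (h𝒞 : ∀ C ∈ 𝒞, C.Nonempty ∧ PolyCone.IsPolyhedralCone C)
    (lam : ℝ) (hlam : lam ∈ Set.Ioc (0 : ℝ) 1)
    (x : ℕ → X) (R : ℕ → X → X)
    (hR : ∀ n, R n ∈ PolyCone.relaxedProjectors 𝒞 (Set.Icc lam (2 - lam)))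
    (hx : ∀ n, x (n + 1) = R n (x n)) :
    ∀ γ : ℝ, 0 < γ → Summable (fun n : ℕ => ‖x (n + 1) - x n‖ ^ γ) := by
  intro γ hγ
  have hex : ∀ C : 𝒞, ∃ 𝓜 : Set (Submodule ℝ X), 𝓜.Finite ∧
      (∀ M ∈ 𝓜, FiniteDimensional ℝ M) ∧ ∀ x, ∀ μ ∈ Set.Icc lam (2 - lam), ∃ M ∈ 𝓜,
        PolyCone.Step lam M x ((1 - μ) • x + μ • PolyCone.projector (C : Set X) x) :=
    fun C => (h𝒞 C C.2).2.exists_finite_steps (h𝒞 C C.2).1 lam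
  choose 𝓜 h𝓜fin h𝓜fd h𝓜 using hex
  have := h𝒞_fin.to_subtype
  have hfin : (⋃ C, 𝓜 C).Finite := Set.finite_iUnion h𝓜fin
  have hfd : ∀ M ∈ ⋃ C, 𝓜 C, FiniteDimensional ℝ M := by
    intro M hM
    obtain ⟨C, hC⟩ := Set.mem_iUnion.1 hM
    exact h𝓜fd C M hC
  have hstep : ∀ n, ∃ M ∈ ⋃ C, 𝓜 C, PolyCone.Step lam M (x n) (x (n + 1)) := by
    intro n
    obtain ⟨C, hC, μ, hμ, hRn⟩ := hR n
    obtain ⟨M, hM, hs⟩ := h𝓜 ⟨C, hC⟩ (x n) μ hμ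
    refine ⟨M, Set.mem_iUnion.2 ⟨_, hM⟩, ?_⟩
    rw [hx n, hRn]
    exact hs
  choose M hM𝓜 hM using hstep
  have hT : ∀ n, PolyCone.IsTrajectory lam (⋃ C, 𝓜 C) M x n := fun n i _ => ⟨hM𝓜 i, hM i⟩
  have := PolyCone.finiteDimensional_sSup hfin hfd
  obtain ⟨K, -, hK⟩ := PolyCone.exists_sum_rpow_le hlam hfin hfd hγ
    (Module.finrank ℝ (sSup (⋃ C, 𝓜 C) : Submodule ℝ X))
  refine summable_of_sum_range_le (fun n => Real.rpow_nonneg (norm_nonneg _) _)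
    fun n => hK M x n (hT n) (Submodule.finrank_mono ?_)
  exact PolyCone.supUpTo_le_iff.2 fun i _ => le_sSup (hM𝓜 i)
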